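/- Let $F:\mathsf{Set}\to\mathsf{Set}$ be a functor that preserves weak pullbacks, let $C$ be a set (of colours), and let $F_C$ be the functor $F_C S = C\times FS$, $F_C f=\mathrm{id}_C\times Ff$; an $F_C$-coalgebra is written $(S',\langle\gamma,\sigma'\rangle)$ with $\gamma:S'\to C$ and $\sigma':S'\to FS'$, and $(S',\sigma')$ is its $F$-reduct. For a functor $G:\mathsf{Set}\to\mathsf{Set}$ and a relation $Z\subseteq S\times T$ with projections $\pi:Z\to S$, $\pi':Z\to T$, put $\overline{G}Z=\{(G\pi(\varphi),G\pi'(\varphi)) : \varphi\in GZ\}\subseteq GS\times GT$. A bisimulation between $G$-coalgebras $(S,\sigma)$ and $(T,\tau)$ is a relation $Z\subseteq S\times T$ with $(\sigma(s),\tau(t))\in\overline{G}Z$ for all $(s,t)\in Z$; two states are bisimilar if some bisimulation links them. A parity $G$-automaton $\mathbb A=(A,a_I,\Delta,\Omega)$ consists of a finite set $A$, a state $a_I\in A$, and maps $\Delta:A\to\mathcal P\mathcal P(GA)$ and $\Omega:A\to\mathbb N$. Its size is $|A|$, its index is $|\Omega[A]|$, and it is nondeterministic if every member of every $\Delta(a)$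 is a singleton. It accepts a pointed $G$-coalgebra $((S,\sigma),s)$ if $\exists$ has a winning strategy (possibly depending on the history of the match) from position $(s,a_I)$ in the following two-player game. At a position $(t,a)\in S\times A$, $\exists$ moves to $(t,\Phi)$ for some $\Phi\in\Delta(a)$; at $(t,\Phi)$, $\forall$ moves to $(t,\varphi)$ for some $\varphi\in\Phi$; at $(t,\varphi)\in S\times GA$, $\exists$ moves to some $Z\subseteq S\times A$ with $(\sigma(t),\varphi)\in\overline{G}Z$; at $Z$, $\forall$ moves to some $(t',b)\in Z$. A player who cannot move loses; an infinite match is won by $\exists$ iff the greatest number occurring infinitely often in $\Omega(a_0)\Omega(a_1)\Omega(a_2)\cdots$ is even, where $a_0a_1a_2\cdots$ are the automaton states in the successive positions from $S\times A$. Let $\mathbb A=(A,a_I,\Delta,\Omega)$ be a nondeterministic parity $F_C$-automaton of size $n$ and index $k$, and define the parity $F$-automaton $\pi_F\mathbb A=(A,a_I,\Delta_\pi,\Omega)$ by $$\Delta_\pi(a)=\bigcup_{c\in C}\{\Phi\subseteq FA : \{c\}\times\Phi\in\Delta(a)\}.$$ Then $\pi_F\mathbb A$ is nondeterministic, has size $n$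 and index $k$, and for every pointed $F$-coalgebra $(\mathbb S,s)$ the following are equivalent: (1) $\pi_F\mathbb A$ accepts $(\mathbb S,s)$; (2) $\mathbb A$ accepts some pointed $F_C$-coalgebra $((S',\langle\gamma,\sigma'\rangle),s')$ such that $((S',\sigma'),s')$ and $(\mathbb S,s)$ are bisimilar. -/

import Mathlib

open CategoryTheory CategoryTheory.Limits

universe u

/-! ## Weak pullbacks -/

/-- A set functor preserves weak pullbacks if it sends every weak pullback square to a weak
pullback square. -/
def PreservesWeakPullbacks (F : Type u ⥤ Type u) : Prop :=
  ∀ ⦃P X Y Z : Type u⦄ (p : P ⟶ X) (q : P ⟶ Y) (f : X ⟶ Z) (g : Y ⟶ Z) (w : p ≫ f = q ≫ g),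
    Nonempty (IsWeakLimit (PullbackCone.mk p q w)) →
      Nonempty (IsWeakLimit (PullbackCone.mk (F.map p) (F.map q)
        (by rw [← F.map_comp, w, F.map_comp] : F.map p ≫ F.map f = F.map q ≫ F.map g)))

/-! ## Relation lifting, bisimilarity and coloured coalgebras -/

/-- The lifted relation: the image of `F Z` under `⟨F π, F π'⟩`, where `π : Z → S` and
`π' : Z → T` are the two projections of the relation `Z ⊆ S × T`. -/
def relLift (F : Type u ⥤ Type u) {S T : Type u} (Z : Set (S × T)) : Set (F.obj S × F.obj T) :=
  {xy | ∃ φ : F.obj Z, F.map (TypeCat.ofHom fun z : Z => z.1.1) φ = xy.1 ∧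
    F.map (TypeCat.ofHom fun z : Z => z.1.2) φ = xy.2}

/-- `Z` is an `F`-bisimulation between the coalgebras `S` and `T`. -/
def IsBisimulation {F : Type u ⥤ Type u} (S T : Endofunctor.Coalgebra F)
    (Z : Set (S.V × T.V)) : Prop :=
  ∀ s t, (s, t) ∈ Z → (S.str s, T.str t) ∈ relLift F Z

/-- The states `s` of `S` and `t` of `T` are bisimilar. -/
def Bisimilar {F : Type u ⥤ Type u} (S : Endofunctor.Coalgebra F) (s : S.V)
    (T : Endofunctor.Coalgebra F) (t : T.V) : Prop :=
  ∃ Z : Set (S.V × T.V), IsBisimulation S T Z ∧ (s, t) ∈ Z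

/-- The functor `F_C`, with `F_C S = C × F S` and `F_C f = id_C × F f`. -/
def coloured (C : Type u) (F : Type u ⥤ Type u) : Type u ⥤ Type u where
  obj S := C × F.obj S
  map f := TypeCat.ofHom fun x => (x.1, F.map f x.2)
  map_id := by intro X; ext x <;> simp
  map_comp := by intro X Y Z f g; ext x <;> simp

/-- The `F`-reduct `(S, σ)` of a `C`-coloured `F`-coalgebra `(S, ⟨γ, σ⟩)`. -/
def reduct {C : Type u} {F : Type u ⥤ Type u} (S : Endofunctor.Coalgebra (coloured C F)) :
    Endofunctor.Coalgebra F where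
  V := S.V
  str := TypeCat.ofHom fun s => (S.str s : C × F.obj S.V).2

/-! ## Graph games -/

/-- The two players, `∃` and `∀`. -/
inductive Player
  | eloise
  | abelard

/-- A graph game with board `B`: every position belongs to one of the players, `edge b` is the set
of admissible moves from `b`, and `ref` is the set of infinite sequences of positions
that `∃` wins. -/
structure GraphGame (B : Type*) where
  owner : B → Player
  edge : B → Set B
  ref : Set (ℕ → B)

namespace GraphGame

variable {B : Type*} (G : GraphGame B)

/-- The nonempty finite sequence `π` of positions is a play starting at `b`. -/
def IsFinitePlay (b : B) (π : List B) : Prop :=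
  π.head? = some b ∧ π.IsChain fun x y => y ∈ G.edge x

/-- The infinite sequence `π` of positions is a play starting at `b`. -/
def IsInfinitePlay (b : B) (π : ℕ → B) : Prop :=
  π 0 = b ∧ ∀ n, π (n + 1) ∈ G.edge (π n)

/-- The finite play `π` is conform the strategy `f` of player `i`. A strategy is a function from
finite sequences of positions to positions; only its values on plays that end in a position of
player `i` matter. -/
def FiniteConform (i : Player) (f : List B → B) (π : List B) : Prop :=
  ∀ (β : List B) (x y : B), β ++ [x, y] <+: π → G.owner x = i → y = f (β ++ [x])

/-- The infinite play `π` is conform the strategy `f` of player `i`. -/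
def InfiniteConform (i : Player) (f : List B → B) (π : ℕ → B) : Prop :=
  ∀ n, G.owner (π n) = i → π (n + 1) = f ((List.range (n + 1)).map π)

/-- Player `i` is the winner of the infinite play `π`. -/
def WinsInfinite : Player → (ℕ → B) → Prop
  | .eloise, π => π ∈ G.ref
  | .abelard, π => π ∉ G.ref

/-- The strategy `f` is winning for player `i` from position `b`: in every play from `b` that is
conform `f`, (1) the strategy makes admissible moves whenever there are any, (2) player `i`
does not get stuck, and (3) if the play is infinite then `i` wins it. -/
def IsWinningStrategy (i : Player) (f : List B → B) (b : B) : Prop :=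
  (∀ (β : List B) (x : B), G.IsFinitePlay b (β ++ [x]) → G.FiniteConform i f (β ++ [x]) →
    G.owner x = i → (G.edge x).Nonempty → f (β ++ [x]) ∈ G.edge x) ∧
  (∀ (β : List B) (x : B), G.IsFinitePlay b (β ++ [x]) → G.FiniteConform i f (β ++ [x]) →
    G.owner x = i → (G.edge x).Nonempty) ∧
  (∀ π : ℕ → B, G.IsInfinitePlay b π → G.InfiniteConform i f π → G.WinsInfinite i π)

/-- The set of winning positions of player `i`. -/
def win (i : Player) : Set B :=
  {b | ∃ f : List B → B, G.IsWinningStrategy i f b}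

end GraphGame

/-! ## Coalgebra automata -/

/-- An (alternating) parity `F`-automaton `(A, a_I, Δ, Ω)`, with `A` finite and
`Δ : A → 𝒫 𝒫 (F A)`. -/
structure ParityAutomaton (F : Type u ⥤ Type u) where
  State : Type u
  finite : Finite State
  init : State
  trans : State → Set (Set (F.obj State))
  priority : State → ℕ

namespace ParityAutomaton

variable {F : Type u ⥤ Type u} (A : ParityAutomaton F)

/-- Each member of each `Δ(a)` is a singleton. -/
def IsNondeterministic : Prop :=
  ∀ a, ∀ Φ ∈ A.trans a, ∃ φ, Φ = {φ}

/-- The number of states. -/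
noncomputable def size : ℕ := Nat.card A.State

/-- The size of the range of the priority map. -/
noncomputable def index : ℕ := (Set.range A.priority).ncard

/-- The parity acceptance condition: the greatest priority occurring infinitely often is even. -/
def acc : Set (ℕ → A.State) :=
  {α | ∃ m, IsGreatest {k | ∃ᶠ n in Filter.atTop, A.priority (α n) = k} m ∧ Even m}

/-- The positions of the acceptance game of `A` on a coalgebra with carrier `S`: the disjoint union
of `S × A`, `S × 𝒫 (F A)`, `S × F A` and `𝒫 (S × A)`. -/
inductive Position (S : Type u) : Type u
  | basic (s : S) (a : A.State)
  | choice (s : S) (Φ : Set (F.obj A.State))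
  | succ (s : S) (φ : F.obj A.State)
  | rel (Z : Set (S × A.State))

variable {A} in
/-- The player who has to move at a position. -/
def Position.owner {S : Type u} : A.Position S → Player
  | .basic _ _ => .eloise
  | .choice _ _ => .abelard
  | .succ _ _ => .eloise
  | .rel _ => .abelard

variable {A} in
/-- The admissible moves of the acceptance game. -/
def Position.moves (S : Endofunctor.Coalgebra F) : A.Position S.V → Set (A.Position S.V)
  | .basic s a => {p | ∃ Φ ∈ A.trans a, p = .choice s Φ}
  | .choice s Φ => {p | ∃ φ ∈ Φ, p = .succ s φ}
  | .succ s φ => {p | ∃ Z, (S.str s, φ) ∈ relLift F Z ∧ p = .rel Z}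
  | .rel Z => {p | ∃ t b, (t, b) ∈ Z ∧ p = .basic t b}

/-- `α` is the sequence of states of `A` that the infinite match `μ` passes through; here `e`
enumerates the times at which `μ` is in a basic position. -/
def InducedSequence {S : Type u} (μ : ℕ → A.Position S) (α : ℕ → A.State) : Prop :=
  ∃ e : ℕ → ℕ, StrictMono e ∧ (∀ n, (∃ s a, μ n = .basic s a) ↔ n ∈ Set.range e) ∧
    ∀ k, ∃ s, μ (e k) = .basic s (α k)

/-- The acceptance game of the automaton `A` on the coalgebra `S`. -/
def acceptanceGame (S : Endofunctor.Coalgebra F) : GraphGame (A.Position S.V) where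
  owner := Position.owner
  edge := Position.moves S
  ref := {μ | ∃ α, A.InducedSequence μ α ∧ α ∈ A.acc}

/-- `A` accepts the pointed coalgebra `(S, s)`. -/
def Accepts (S : Endofunctor.Coalgebra F) (s : S.V) : Prop :=
  .basic s A.init ∈ (A.acceptanceGame S).win .eloise

/-- The transition function `A × C → 𝒫 𝒫 (F A)` of the `C`-chromatic companion of an
`F_C`-automaton: `Φ ∈ Δ_C(a, c)` iff `{c} × Φ ∈ Δ(a)`. -/
def chromaticTrans {C : Type u} (A : ParityAutomaton (coloured C F)) (a : A.State) (c : C) :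
    Set (Set (F.obj A.State)) :=
  {Φ | ({x : C × F.obj A.State | x.1 = c ∧ x.2 ∈ Φ} : Set (C × F.obj A.State)) ∈ A.trans a}

/-- The `F`-projection of an `F_C`-automaton: `Δ_π(a)` is the union of the sets `Δ_C(a, c)`,
for `c ∈ C`. -/
def projection {C : Type u} (A : ParityAutomaton (coloured C F)) : ParityAutomaton F where
  State := A.State
  finite := A.finite
  init := A.init
  trans a := ⋃ c : C, A.chromaticTrans a c
  priority := A.priority

end ParityAutomaton

/-! ## Relation lifting -/

/-! For a nondeterministic automaton, acceptance is equivalent to the existence of an accepting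
`Run`. Inside a round ∀ has no real choice, so a winning strategy, unfolded into its conform
histories, assigns one transition to each history (`Accepts.nonempty_run`). Conversely ∃ wins by
tracking a node of the run (`Run.accepts`).

On runs both directions are direct. A run of the projection uses at each node a transition that
comes from some colour; choosing one turns the nodes themselves into a coloured coalgebra, bisimilar
to the given one via the labelling by points (`Run.exists_coloured`). Nodes are needed because
different visits to one state may call for different colours. Conversely, a run of the original
automaton is transported along a bisimulation by relational composition
(`Run.projection_of_bisimilar`); this rests on `relLift_comp`, the only use of weak pullbacks. -/

theorem mem_relLift_of_forall_mem (F : Type u ⥤ Type u) {X S T : Type u} {Z : Set (S × T)}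
    (f : X → S) (g : X → T) (h : ∀ x, (f x, g x) ∈ Z) (ψ : F.obj X) :
    (F.map (TypeCat.ofHom f) ψ, F.map (TypeCat.ofHom g) ψ) ∈ relLift F Z := by
  refine ⟨F.map (TypeCat.ofHom fun x => (⟨(f x, g x), h x⟩ : Z)) ψ, ?_, ?_⟩
  · rw [← Functor.map_comp_apply]; rfl
  · rw [← Functor.map_comp_apply]; rfl

/-- Apply `F` to a section of the surjection from `D` onto its image. A witness over labels thus
becomes one over nodes, which can serve as the successor structure of a coalgebra. -/
theorem exists_of_mem_relLift_image {F : Type u ⥤ Type u} {X S T : Type u} {D : Set X}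
    {f : X → S} {g : X → T} {x : F.obj S} {y : F.obj T}
    (h : (x, y) ∈ relLift F ((fun m => (f m, g m)) '' D)) :
    ∃ ψ : F.obj D, F.map (TypeCat.ofHom fun m : D => f m) ψ = x ∧
      F.map (TypeCat.ofHom fun m : D => g m) ψ = y := by
  obtain ⟨φ, rfl, rfl⟩ := h
  have hz : ∀ z : ((fun m => (f m, g m)) '' D : Set (S × T)), ∃ m : D, (f m, g m) = z.1 := by
    rintro ⟨_, m, hm, rfl⟩
    exact ⟨⟨m, hm⟩, rfl⟩
  choose e he using hz
  refine ⟨F.map (TypeCat.ofHom e) φ, ?_, ?_⟩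
  · rw [← Functor.map_comp_apply]
    congr 3
    ext z
    exact congrArg Prod.fst (he z)
  · rw [← Functor.map_comp_apply]
    congr 3
    ext z
    exact congrArg Prod.snd (he z)

theorem relLift_mono {F : Type u ⥤ Type u} {S T : Type u} {Z Z' : Set (S × T)} (h : Z ⊆ Z') :
    relLift F Z ⊆ relLift F Z' := by
  rintro ⟨_, _⟩ ⟨φ, rfl, rfl⟩
  exact mem_relLift_of_forall_mem F (fun z : Z => z.1.1) (fun z : Z => z.1.2)
    (fun z => h z.2) φ

theorem relLift_swap {F : Type u ⥤ Type u} {S T : Type u} {Z : Set (S × T)}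
    {x : F.obj S} {y : F.obj T} (h : (x, y) ∈ relLift F Z) :
    (y, x) ∈ relLift F (Prod.swap ⁻¹' Z : Set (T × S)) := by
  obtain ⟨φ, rfl, rfl⟩ := h
  exact mem_relLift_of_forall_mem F (fun z : Z => z.1.2) (fun z : Z => z.1.1)
    (Z := Prod.swap ⁻¹' Z) (fun z => z.2) φ

/-- Composable pairs form the pullback of the two projections to `S`; since `F` keeps it weakly
universal, the two witnesses, which agree in `F.obj S`, have a common lift. -/
theorem relLift_comp {F : Type u ⥤ Type u} (hF : PreservesWeakPullbacks F) {R S T : Type u}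
    {Z : Set (R × S)} {Z' : Set (S × T)} {x : F.obj R} {y : F.obj S} {z : F.obj T}
    (h : (x, y) ∈ relLift F Z) (h' : (y, z) ∈ relLift F Z') :
    (x, z) ∈ relLift F {p : R × T | ∃ s, (p.1, s) ∈ Z ∧ (s, p.2) ∈ Z'} := by
  obtain ⟨φ, rfl, hφ⟩ := h
  obtain ⟨φ', hφ', rfl⟩ := h'
  let f : (Z : Type u) ⟶ S := TypeCat.ofHom fun z => z.1.2
  let g : (Z' : Type u) ⟶ S := TypeCat.ofHom fun z => z.1.1
  obtain ⟨L⟩ := hF _ _ f g (Types.pullbackCone f g).condition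
    ⟨(Types.pullbackLimitCone f g).isLimit.isWeakLimit⟩
  have w : (TypeCat.ofHom fun _ : PUnit.{u + 1} => φ) ≫ F.map f =
      (TypeCat.ofHom fun _ : PUnit.{u + 1} => φ') ≫ F.map g := by
    ext _
    exact hφ.trans hφ'.symm
  let ψ : F.obj (Types.PullbackObj f g) := PullbackCone.IsWeakLimit.lift L _ _ w PUnit.unit
  have h1 : F.map (TypeCat.ofHom fun p : Types.PullbackObj f g => p.1.1) ψ = φ :=
    ConcreteCategory.congr_hom (PullbackCone.IsWeakLimit.lift_fst L _ _ w) PUnit.unit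
  have h2 : F.map (TypeCat.ofHom fun p : Types.PullbackObj f g => p.1.2) ψ = φ' :=
    ConcreteCategory.congr_hom (PullbackCone.IsWeakLimit.lift_snd L _ _ w) PUnit.unit
  rw [← h1, ← h2, ← Functor.map_comp_apply, ← Functor.map_comp_apply]
  have hmem : ∀ p : Types.PullbackObj f g,
      (p.1.1.1.1, p.1.2.1.2) ∈ {p : R × T | ∃ s, (p.1, s) ∈ Z ∧ (s, p.2) ∈ Z'} := fun p => by
    have hp : p.1.1.1.2 = p.1.2.1.1 := p.2
    exact ⟨p.1.1.1.2, p.1.1.2, hp ▸ p.1.2.2⟩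
  exact mem_relLift_of_forall_mem F _ _ hmem ψ

theorem mem_relLift_coloured_iff {C : Type u} {F : Type u ⥤ Type u} {S T : Type u}
    {Z : Set (S × T)} {x : C × F.obj S} {y : C × F.obj T} :
    ((x, y) : (coloured C F).obj S × (coloured C F).obj T) ∈ relLift (coloured C F) Z ↔
      x.1 = y.1 ∧ (x.2, y.2) ∈ relLift F Z := by
  constructor
  · rintro ⟨φ, rfl, rfl⟩
    exact ⟨rfl, φ.2, rfl, rfl⟩
  · rintro ⟨h, φ, h1, h2⟩
    exact ⟨(x.1, φ), Prod.ext rfl h1, Prod.ext h h2⟩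

/-! ## Runs of nondeterministic automata -/

namespace ParityAutomaton

variable {F : Type u ⥤ Type u}

/-- An accepting run of a nondeterministic automaton on a pointed coalgebra: a graph of nodes
labelled by pairs in `S × A`, in which every node carries a transition that is realized by the
labels of its children, and every path from the root satisfies the acceptance condition. -/
structure Run (A : ParityAutomaton F) (S : Endofunctor.Coalgebra F) (s : S.V) where
  Node : Type u
  root : Node
  point : Node → S.V
  state : Node → A.State
  succ : Node → F.obj A.State
  child : Node → Set Node
  point_root : point root = s
  state_root : state root = A.init
  succ_mem : ∀ n, {succ n} ∈ A.trans (state n)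
  succ_lift : ∀ n, (S.str (point n), succ n) ∈ relLift F ((fun m => (point m, state m)) '' child n)
  path_acc : ∀ p : ℕ → Node, p 0 = root → (∀ k, p (k + 1) ∈ child (p k)) →
    (fun k => state (p k)) ∈ A.acc

theorem singleton_mem_chromaticTrans_iff {C : Type u} {A : ParityAutomaton (coloured C F)}
    {a : A.State} {c : C} {φ : F.obj A.State} :
    {φ} ∈ A.chromaticTrans a c ↔
      ({(c, φ)} : Set ((coloured C F).obj A.State)) ∈ A.trans a := by
  have : {x : C × F.obj A.State | x.1 = c ∧ x.2 ∈ ({φ} : Set (F.obj A.State))} = {(c, φ)} := by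
    ext x
    simp [Prod.ext_iff]
  change {x : C × F.obj A.State | x.1 = c ∧ x.2 ∈ ({φ} : Set (F.obj A.State))} ∈ A.trans a ↔ _
  rw [this]
  rfl

/-- A product `{c} × Φ` is a singleton only if `Φ` is one. -/
theorem IsNondeterministic.projection {C : Type u} {A : ParityAutomaton (coloured C F)}
    (hA : A.IsNondeterministic) : A.projection.IsNondeterministic := by
  intro a Φ hΦ
  obtain ⟨c, hc⟩ := Set.mem_iUnion.1 hΦ
  obtain ⟨⟨d, φ⟩, hφ⟩ := hA a _ hc
  have key : ∀ x : C × F.obj A.State, x.1 = c ∧ x.2 ∈ Φ ↔ x = (d, φ) := fun x =>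
    Set.ext_iff.1 hφ x
  have h := (key (d, φ)).2 rfl
  refine ⟨φ, Set.ext fun y => ⟨fun hy => ?_, ?_⟩⟩
  · exact congrArg Prod.snd ((key (c, y)).1 ⟨rfl, hy⟩)
  · rintro rfl
    exact h.2

/-- The nodes of a run of the projection form a coloured coalgebra, which `A` accepts. -/
theorem Run.exists_coloured {C : Type u} {A : ParityAutomaton (coloured C F)}
    {S : Endofunctor.Coalgebra F} {s : S.V} (R : A.projection.Run S s) :
    ∃ (S' : Endofunctor.Coalgebra (coloured C F)) (s' : S'.V),
      Nonempty (A.Run S' s') ∧ Bisimilar (reduct S') s' S s := by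
  have hc : ∀ n, ∃ c : C,
      ({(c, R.succ n)} : Set ((coloured C F).obj A.State)) ∈ A.trans (R.state n) := by
    intro n
    obtain ⟨c, hc⟩ := Set.mem_iUnion.1 (R.succ_mem n)
    exact ⟨c, singleton_mem_chromaticTrans_iff.1 hc⟩
  choose c hc using hc
  have hψ : ∀ n, ∃ ψ : F.obj (R.child n),
      F.map (TypeCat.ofHom fun m : R.child n => R.point m) ψ = S.str (R.point n) ∧
      F.map (TypeCat.ofHom fun m : R.child n => R.state m) ψ = R.succ n := fun n =>
    exists_of_mem_relLift_image (R.succ_lift n)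
  choose ψ hψ1 hψ2 using hψ
  let S' : Endofunctor.Coalgebra (coloured C F) :=
    { V := R.Node
      str := TypeCat.ofHom fun n =>
        ((c n, F.map (TypeCat.ofHom fun m : R.child n => m.1) (ψ n)) : C × F.obj R.Node) }
  -- The bisimulation is the graph of `R.point`; the run on `S'` is `R` with every node labelled by
  -- itself.
  refine ⟨S', R.root, ⟨?_⟩, {p | R.point p.1 = p.2}, ?_, R.point_root⟩
  · exact
    { Node := R.Node
      root := R.root
      point := id
      state := R.state
      succ := fun n => (c n, R.succ n)
      child := R.child
      point_root := rfl
      state_root := R.state_root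
      succ_mem := hc
      succ_lift := fun n => by
        refine mem_relLift_coloured_iff.2 ⟨rfl, ?_⟩
        have := mem_relLift_of_forall_mem F (fun m : R.child n => m.1)
          (fun m : R.child n => R.state m)
          (Z := (fun m => (id m, R.state m)) '' R.child n) (fun m => ⟨m, m.2, rfl⟩) (ψ n)
        rw [hψ2] at this
        exact this
      path_acc := R.path_acc }
  · intro (n : R.Node) t hn
    obtain rfl : R.point n = t := hn
    have := mem_relLift_of_forall_mem F (fun m : R.child n => m.1)
      (fun m : R.child n => R.point m)
      (Z := {p : R.Node × S.V | R.point p.1 = p.2}) (fun m => rfl) (ψ n)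
    rw [hψ1] at this
    exact this

/-- A run on a coloured coalgebra projects to a run on any coalgebra bisimilar to the reduct. -/
theorem Run.projection_of_bisimilar {C : Type u} (hF : PreservesWeakPullbacks F)
    {A : ParityAutomaton (coloured C F)} {S' : Endofunctor.Coalgebra (coloured C F)} {s' : S'.V}
    (R : A.Run S' s') {S : Endofunctor.Coalgebra F} {s : S.V}
    (h : Bisimilar (reduct S') s' S s) : Nonempty (A.projection.Run S s) := by
  obtain ⟨Z, hZ, hs⟩ := h
  refine ⟨
    -- A node of `R` is paired with a state of `S` that `Z` links to its point; paths project to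
    -- paths of `R` with the same automaton states.
    { Node := {p : R.Node × S.V // (R.point p.1, p.2) ∈ Z}
      root := ⟨(R.root, s), ?_⟩
      point := fun n => n.1.2
      state := fun n => R.state n.1.1
      succ := fun n => (R.succ n.1.1 : C × F.obj A.State).2
      child := fun n => {m | m.1.1 ∈ R.child n.1.1}
      point_root := rfl
      state_root := R.state_root
      succ_mem := fun n => ?_
      succ_lift := fun n => ?_
      path_acc := fun p hp hc => R.path_acc (fun k => (p k).1.1) ?_ hc }⟩
  · rw [R.point_root]
    exact hs
  · exact Set.mem_iUnion.2 ⟨(R.succ n.1.1 : C × F.obj A.State).1,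
      singleton_mem_chromaticTrans_iff.2 (R.succ_mem n.1.1)⟩
  · have h1 := relLift_swap (hZ _ _ n.2)
    have h2 := (mem_relLift_coloured_iff.1 (R.succ_lift n.1.1)).2
    have h3 := relLift_comp hF h1 h2
    refine relLift_mono ?_ h3
    rintro ⟨t, a⟩ ⟨t', ht, m, hm, he⟩
    obtain ⟨rfl, rfl⟩ := Prod.mk.inj he
    exact ⟨⟨(m, t), ht⟩, hm, rfl⟩
  · simp only [hp]

end ParityAutomaton

/-! ## Plays conform a strategy -/

namespace GraphGame

variable {B : Type*} {G : GraphGame B} {b : B} {i : Player} {f : List B → B}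

theorem IsFinitePlay.concat {β : List B} {x y : B} (h : G.IsFinitePlay b (β ++ [x]))
    (hy : y ∈ G.edge x) : G.IsFinitePlay b (β ++ [x] ++ [y]) := by
  refine ⟨by simpa using h.1, ?_⟩
  refine List.isChain_append.2 ⟨h.2, by simp, ?_⟩
  simpa using hy

theorem FiniteConform.concat {β : List B} {x y : B} (h : G.FiniteConform i f (β ++ [x]))
    (hy : G.owner x = i → y = f (β ++ [x])) : G.FiniteConform i f (β ++ [x] ++ [y]) := by
  intro γ u v hp hu
  rcases List.prefix_concat_iff.1 hp with hp | hp
  · have h1 : γ ++ [u] ++ [v] = β ++ [x] ++ [y] := by simpa using hp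
    obtain ⟨h2, h3⟩ := List.append_inj' h1 rfl
    obtain ⟨h4, h5⟩ := List.append_inj' h2 rfl
    simp only [List.cons.injEq, and_true] at h3 h5
    subst h3 h4 h5
    exact hy hu
  · exact h γ u v hp hu

theorem FiniteConform.of_prefix {π π' : List B} (h : G.FiniteConform i f π) (hp : π' <+: π) :
    G.FiniteConform i f π' :=
  fun γ u v huv => h γ u v (huv.trans hp)

/-- The infinite sequence `π` is a play conform `f` as soon as all its finite initial segments
are, arbitrarily long ones sufficing. -/
theorem isInfinitePlay_and_infiniteConform {π : ℕ → B}
    (h : ∀ n, ∃ m, n ≤ m ∧ G.IsFinitePlay b ((List.range m).map π) ∧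
      G.FiniteConform i f ((List.range m).map π)) :
    G.IsInfinitePlay b π ∧ G.InfiniteConform i f π := by
  refine ⟨⟨?_, fun n => ?_⟩, fun n hn => ?_⟩
  · obtain ⟨m, hm, hplay, -⟩ := h 1
    obtain ⟨m, rfl⟩ := Nat.exists_eq_add_of_le' hm
    have := hplay.1
    rw [List.range_succ_eq_map] at this
    simpa using this
  · obtain ⟨m, hm, hplay, -⟩ := h (n + 2)
    have := List.isChain_iff_getElem.1 hplay.2 n (by simp; omega)
    simpa using this
  · obtain ⟨m, hm, -, hconf⟩ := h (n + 2)
    obtain ⟨k, rfl⟩ := Nat.exists_eq_add_of_le hm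
    have := hconf ((List.range n).map π) (π n) (π (n + 1)) ?_ hn
    · simpa [List.range_succ] using this
    · rw [List.range_add, List.map_append]
      refine List.IsPrefix.trans ?_ (List.prefix_append _ _)
      simp [List.range_succ]

end GraphGame

namespace ParityAutomaton

variable {F : Type u ⥤ Type u} {A : ParityAutomaton F}

/-- A round takes four moves, so the basic positions occur exactly at the multiples of 4, and a
strictly increasing enumeration is determined by its range. -/
theorem inducedSequence_iff {S : Type u} {μ : ℕ → A.Position S} {t : ℕ → S} {a : ℕ → A.State}
    (h0 : ∀ i, μ (4 * i) = .basic (t i) (a i))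
    (h1 : ∀ i r, 0 < r → r < 4 → ∀ s b, μ (4 * i + r) ≠ .basic s b) {α : ℕ → A.State} :
    A.InducedSequence μ α ↔ α = a := by
  have hmono : StrictMono fun k : ℕ => 4 * k := fun i j h => by dsimp only; omega
  have hb : ∀ n, (∃ s b, μ n = .basic s b) ↔ n ∈ Set.range fun k : ℕ => 4 * k := by
    intro n
    constructor
    · rintro ⟨s, b, h⟩
      by_contra hn
      refine h1 (n / 4) (n % 4) (Nat.pos_of_ne_zero fun h0 => hn ⟨n / 4, ?_⟩)
        (Nat.mod_lt _ (by norm_num)) s b ?_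
      · dsimp only; omega
      · rwa [Nat.div_add_mod]
    · rintro ⟨k, rfl⟩
      exact ⟨_, _, h0 k⟩
  constructor
  · rintro ⟨e, he, hr, hs⟩
    obtain rfl : e = fun k : ℕ => 4 * k :=
      (StrictMono.range_inj he hmono).1 (Set.ext fun n => (hr n).symm.trans (hb n))
    funext k
    obtain ⟨s, hk⟩ := hs k
    have := hk.symm.trans (h0 k)
    simp only [Position.basic.injEq] at this
    exact this.2
  · rintro rfl
    exact ⟨_, hmono, hb, fun k => ⟨_, h0 k⟩⟩

/-! ### From winning strategies to runs -/

/-- Since `Φ` is a singleton, the history fixes the round up to `Z`; the only branching is ∀'s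
choice of a pair in `Z`. -/
theorem exists_round {S : Endofunctor.Coalgebra F} (hA : A.IsNondeterministic)
    {b : A.Position S.V} {f : List (A.Position S.V) → A.Position S.V}
    (hf : (A.acceptanceGame S).IsWinningStrategy .eloise f b) {β : List (A.Position S.V)}
    {t : S.V} {a : A.State} (hp : (A.acceptanceGame S).IsFinitePlay b (β ++ [.basic t a]))
    (hc : (A.acceptanceGame S).FiniteConform .eloise f (β ++ [.basic t a])) :
    ∃ (φ : F.obj A.State) (Z : Set (S.V × A.State)), {φ} ∈ A.trans a ∧
      (S.str t, φ) ∈ relLift F Z ∧ ∀ t' a', (t', a') ∈ Z →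
        (A.acceptanceGame S).IsFinitePlay b
          (β ++ [.basic t a, .choice t {φ}, .succ t φ, .rel Z] ++ [.basic t' a']) ∧
        (A.acceptanceGame S).FiniteConform .eloise f
          (β ++ [.basic t a, .choice t {φ}, .succ t φ, .rel Z] ++ [.basic t' a']) := by
  obtain ⟨Φ, hΦ, h1⟩ := hf.1 _ _ hp hc rfl (hf.2.1 _ _ hp hc rfl)
  obtain ⟨φ, rfl⟩ := hA a Φ hΦ
  have hp1 := hp.concat (y := .choice t {φ}) ⟨_, hΦ, rfl⟩
  have hc1 := hc.concat (y := .choice t {φ}) fun _ => h1.symm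
  have hp2 := hp1.concat (y := .succ t φ) ⟨φ, rfl, rfl⟩
  have hc2 := hc1.concat (y := .succ t φ) (fun h => nomatch h)
  obtain ⟨Z, hZ, h3⟩ := hf.1 _ _ hp2 hc2 rfl (hf.2.1 _ _ hp2 hc2 rfl)
  have hp3 := hp2.concat (y := .rel Z) ⟨_, hZ, rfl⟩
  have hc3 := hc2.concat (y := .rel Z) fun _ => h3.symm
  refine ⟨φ, Z, hΦ, hZ, fun t' a' h => ?_⟩
  have hp4 := hp3.concat (y := .basic t' a') ⟨t', a', h, rfl⟩
  have hc4 := hc3.concat (y := .basic t' a') (fun h => nomatch h)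
  simp only [List.append_assoc, List.cons_append, List.nil_append] at hp4 hc4 ⊢
  exact ⟨hp4, hc4⟩

theorem Accepts.nonempty_run (hA : A.IsNondeterministic) {S : Endofunctor.Coalgebra F} {s : S.V}
    (h : A.Accepts S s) : Nonempty (A.Run S s) := by
  obtain ⟨f, hf⟩ := h
  -- A node is a whole conform history, its final basic position stored apart, so the strategy's
  -- dependence on history does no harm.
  let N : Type u := {n : List (A.Position S.V) × S.V × A.State //
    (A.acceptanceGame S).IsFinitePlay (.basic s A.init) (n.1 ++ [.basic n.2.1 n.2.2]) ∧
    (A.acceptanceGame S).FiniteConform .eloise f (n.1 ++ [.basic n.2.1 n.2.2])}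
  choose φ Z hφ hZ hN using fun n : N => exists_round hA hf n.2.1 n.2.2
  let round : N → List (A.Position S.V) := fun n =>
    [.basic n.1.2.1 n.1.2.2, .choice n.1.2.1 {φ n}, .succ n.1.2.1 (φ n), .rel (Z n)]
  refine ⟨
    { Node := N
      root := ⟨([], s, A.init), ⟨rfl, by simp⟩, ?_⟩
      point := fun n => n.1.2.1
      state := fun n => n.1.2.2
      succ := φ
      child := fun n => {m | m.1.1 = n.1.1 ++ round n ∧ (m.1.2.1, m.1.2.2) ∈ Z n}
      point_root := rfl
      state_root := rfl
      succ_mem := hφ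
      succ_lift := fun n => ?_
      path_acc := fun p hp hc => ?_ }⟩
  · intro γ u v huv
    have := huv.length_le
    simp at this
  · refine relLift_mono ?_ (hZ n)
    rintro ⟨t, a⟩ ht
    exact ⟨⟨(n.1.1 ++ round n, t, a), hN n t a ht⟩, ⟨rfl, ht⟩, rfl⟩
  · let π : ℕ → A.Position S.V := fun k => (round (p (k / 4)))[k % 4]'(Nat.mod_lt _ (by simp))
    have hπ : ∀ i r (hr : r < 4), π (4 * i + r) = (round (p i))[r]'hr := by
      intro i r hr
      have h1 : (4 * i + r) / 4 = i := by omega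
      have h2 : (4 * i + r) % 4 = r := by omega
      simp only [π, h1, h2]
    have hrange : ∀ i, (List.range (4 * i)).map π = (p i).1.1 := by
      intro i
      induction i with
      | zero => simp [hp]
      | succ i ih =>
        have h4 : List.range 4 = [0, 1, 2, 3] := rfl
        rw [(hc i).1, ← ih, Nat.mul_succ, List.range_add, List.map_append, h4]
        simp only [List.map_cons, List.map_nil,
          hπ i 0 (by norm_num), hπ i 1 (by norm_num), hπ i 2 (by norm_num), hπ i 3 (by norm_num)]
        rfl
    -- The length is `4 * i + 1` because nodes certify the prefixes that end in their basic
    -- position.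
    have hrange' : ∀ i, (List.range (4 * i + 1)).map π =
        (p i).1.1 ++ [.basic (p i).1.2.1 (p i).1.2.2] := by
      intro i
      rw [List.range_succ, List.map_append, hrange]
      exact congrArg (fun x => _ ++ [x]) (hπ i 0 (by norm_num))
    obtain ⟨hplay, hconf⟩ := GraphGame.isInfinitePlay_and_infiniteConform
      (G := A.acceptanceGame S) (b := .basic s A.init) (i := .eloise) (f := f) (π := π) fun n =>
        ⟨4 * n + 1, by omega, by rw [hrange']; exact (p n).2.1, by rw [hrange']; exact (p n).2.2⟩
    obtain ⟨α, hα, hacc⟩ := hf.2.2 π hplay hconf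
    rw [inducedSequence_iff (t := fun i => (p i).1.2.1) (a := fun i => (p i).1.2.2)
      (fun i => hπ i 0 (by norm_num)) ?_] at hα
    · exact hα ▸ hacc
    · intro i r h0 hr t a
      rw [hπ i r hr]
      interval_cases r <;> simp [round]

/-! ### From runs to winning strategies -/

namespace Run

variable {S : Endofunctor.Coalgebra F} {s : S.V} (R : A.Run S s)

/-- The labels of the children of a node. -/
def childLabels (n : R.Node) : Set (S.V × A.State) :=
  (fun m => (R.point m, R.state m)) '' R.child n

open Classical in
/-- The node reached from `n` when the match moves to a given position: a child with the right
label if the position is basic, and `n` itself otherwise. -/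
noncomputable def step (n : R.Node) : A.Position S.V → R.Node
  | .basic t a => if h : (t, a) ∈ R.childLabels n then h.choose else n
  | _ => n

/-- The move of `∃` suggested by the node `n`. -/
def move (n : R.Node) : A.Position S.V → A.Position S.V
  | .basic t _ => .choice t {R.succ n}
  | .succ _ _ => .rel (R.childLabels n)
  | p => p

/-- The positions in which a match that follows the run can be while it is at node `n`. -/
inductive At (n : R.Node) : A.Position S.V → Prop
  | basic : At n (.basic (R.point n) (R.state n))
  | choice : At n (.choice (R.point n) {R.succ n})
  | succ : At n (.succ (R.point n) (R.succ n))
  | rel : At n (.rel (R.childLabels n))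

variable {R}

theorem step_basic_of_mem {n : R.Node} {t : S.V} {a : A.State} (h : (t, a) ∈ R.childLabels n) :
    R.step n (.basic t a) ∈ R.child n ∧ R.point (R.step n (.basic t a)) = t ∧
      R.state (R.step n (.basic t a)) = a := by
  have hs : R.step n (.basic t a) = h.choose := dif_pos h
  rw [hs]
  exact ⟨h.choose_spec.1, Prod.mk.inj h.choose_spec.2⟩

/-- ∃ plays what the node dictates, ∀'s move from a singleton is forced, and his choice from the
child labels is answered by passing to such a child. -/
theorem At.step {n : R.Node} {x y : A.Position S.V} (h : R.At n x) (hy : y ∈ x.moves S)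
    (hf : x.owner = .eloise → y = R.move n x) : R.At (R.step n y) y := by
  cases h with
  | basic => obtain rfl := hf rfl; exact .choice
  | choice => obtain ⟨_, rfl, rfl⟩ := hy; exact .succ
  | succ => obtain rfl := hf rfl; exact .rel
  | rel =>
    obtain ⟨t, a, h, rfl⟩ := hy
    obtain ⟨-, h1, h2⟩ := step_basic_of_mem h
    have := At.basic (R := R) (n := R.step n (.basic t a))
    rwa [h1, h2] at this

theorem At.move_mem {n : R.Node} {x : A.Position S.V} (h : R.At n x) (hx : x.owner = .eloise) :
    R.move n x ∈ x.moves S := by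
  cases h with
  | basic => exact ⟨_, R.succ_mem n, rfl⟩
  | choice => cases hx
  | succ => exact ⟨_, R.succ_lift n, rfl⟩
  | rel => cases hx

variable (R) in
/-- The node reached after a finite play. -/
noncomputable def node (π : List (A.Position S.V)) : R.Node :=
  -- The initial position is dropped: the root already accounts for it.
  π.tail.foldl R.step R.root

variable (R) in
/-- The strategy of `∃` that follows the run. -/
noncomputable def strategy (π : List (A.Position S.V)) : A.Position S.V :=
  -- The default `.rel ∅` concerns only the empty list, which is never a play.
  R.move (R.node π) (π.getLastD (.rel ∅))

theorem node_concat {β : List (A.Position S.V)} {x y : A.Position S.V} :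
    R.node (β ++ [x] ++ [y]) = R.step (R.node (β ++ [x])) y := by
  rw [node, node, List.tail_append_of_ne_nil (by simp), List.foldl_append]
  rfl

theorem strategy_concat {β : List (A.Position S.V)} {x : A.Position S.V} :
    R.strategy (β ++ [x]) = R.move (R.node (β ++ [x])) x := by
  simp [strategy]

theorem at_node {β : List (A.Position S.V)} {x : A.Position S.V}
    (hp : (A.acceptanceGame S).IsFinitePlay (.basic s A.init) (β ++ [x]))
    (hc : (A.acceptanceGame S).FiniteConform .eloise R.strategy (β ++ [x])) :
    R.At (R.node (β ++ [x])) x := by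
  induction β using List.reverseRecOn generalizing x with
  | nil =>
    obtain rfl : x = .basic s A.init := by simpa using hp.1
    have := At.basic (R := R) (n := R.root)
    rwa [R.point_root, R.state_root] at this
  | append_singleton β y ih =>
    have hpre : β ++ [y] <+: β ++ [y] ++ [x] := List.prefix_append _ _
    have hch := List.isChain_append.1 hp.2
    have hat := ih ⟨by simpa using hp.1, hch.1⟩ (hc.of_prefix hpre)
    rw [node_concat]
    refine hat.step (hch.2.2 y (by simp) x (by simp)) fun hy => ?_
    rw [← strategy_concat]
    exact hc β y x (by simp) hy

end Run

theorem Run.accepts {S : Endofunctor.Coalgebra F} {s : S.V} (R : A.Run S s) : A.Accepts S s := by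
  refine ⟨R.strategy, fun β x hp hc hx _ => ?_, fun β x hp hc hx => ?_, fun π hp hc => ?_⟩
  · rw [Run.strategy_concat]
    exact (Run.at_node hp hc).move_mem hx
  · exact ⟨_, (Run.at_node hp hc).move_mem hx⟩
  · let p : ℕ → R.Node := fun k => R.node ((List.range (k + 1)).map π)
    have hp0 : p 0 = R.root := rfl
    have hmap : ∀ k, (List.range (k + 1)).map π = (List.range k).map π ++ [π k] := fun k => by
      rw [List.range_succ, List.map_append]; rfl
    have hps : ∀ k, p (k + 1) = R.step (p k) (π (k + 1)) := fun k => by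
      simp only [p]
      rw [hmap (k + 1), hmap k, Run.node_concat]
    have hmove : ∀ k, (π k).owner = .eloise → π (k + 1) = R.move (p k) (π k) := fun k hk => by
      rw [hc k hk, hmap, Run.strategy_concat, ← hmap]
    -- The node stays fixed for three moves and passes to a child on the fourth, so the nodes at
    -- times `4 * i` form a path of the run.
    have hround : ∀ i, π (4 * i) = .basic (R.point (p (4 * i))) (R.state (p (4 * i))) →
        π (4 * i + 1) = .choice (R.point (p (4 * i))) {R.succ (p (4 * i))} ∧
        π (4 * i + 2) = .succ (R.point (p (4 * i))) (R.succ (p (4 * i))) ∧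
        π (4 * i + 3) = .rel (R.childLabels (p (4 * i))) ∧
        π (4 * i + 4) = .basic (R.point (p (4 * i + 4))) (R.state (p (4 * i + 4))) ∧
        p (4 * i + 4) ∈ R.child (p (4 * i)) := by
      intro i h0
      have h1 := hmove (4 * i) (by rw [h0]; rfl)
      rw [h0] at h1
      have p1 := hps (4 * i)
      rw [h1] at p1
      change _ = p (4 * i) at p1
      obtain ⟨φ, hφ, h2⟩ : ∃ φ ∈ ({R.succ (p (4 * i))} : Set _), _ := h1 ▸ hp.2 (4 * i + 1)
      obtain rfl := hφ
      have p2 := hps (4 * i + 1)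
      rw [h2] at p2
      change _ = p (4 * i + 1) at p2
      have h3 := hmove (4 * i + 2) (by rw [h2]; rfl)
      rw [h2, p2, p1] at h3
      have p3 := hps (4 * i + 2)
      rw [h3] at p3
      change _ = p (4 * i + 2) at p3
      obtain ⟨t, a, hta, h4⟩ : ∃ t a, (t, a) ∈ R.childLabels (p (4 * i)) ∧ _ :=
        h3 ▸ hp.2 (4 * i + 3)
      have p4 := hps (4 * i + 3)
      rw [h4, p3, p2, p1] at p4
      obtain ⟨hm, ht, ha⟩ := Run.step_basic_of_mem hta
      rw [← p4] at hm ht ha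
      refine ⟨h1, h2, h3, ?_, hm⟩
      rw [ht, ha]
      exact h4
    have hbasic : ∀ i, π (4 * i) = .basic (R.point (p (4 * i))) (R.state (p (4 * i))) := by
      intro i
      induction i with
      | zero =>
        have := hp.1
        rwa [← R.point_root, ← R.state_root] at this
      | succ i ih => exact (hround i ih).2.2.2.1
    refine ⟨fun i => R.state (p (4 * i)), (inducedSequence_iff hbasic ?_).2 rfl,
      R.path_acc (fun i => p (4 * i)) hp0 fun i => (hround i (hbasic i)).2.2.2.2⟩
    intro i r h0 hr t a
    obtain ⟨h1, h2, h3, -⟩ := hround i (hbasic i)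
    interval_cases r
    · rw [h1]; nofun
    · rw [h2]; nofun
    · rw [h3]; nofun

end ParityAutomaton

theorem mainTheorem7 (F : Type u ⥤ Type u) (hF : PreservesWeakPullbacks F) (C : Type u)
    (A : ParityAutomaton (coloured C F)) (hA : A.IsNondeterministic) :
    A.projection.IsNondeterministic ∧
    A.projection.size = A.size ∧
    A.projection.index = A.index ∧
    ∀ (S : Endofunctor.Coalgebra F) (s : S.V),
      A.projection.Accepts S s ↔
        ∃ (S' : Endofunctor.Coalgebra (coloured C F)) (s' : S'.V),
          A.Accepts S' s' ∧ Bisimilar (reduct S') s' S s := by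
  refine ⟨hA.projection, rfl, rfl, fun S s => ⟨fun h => ?_, ?_⟩⟩
  · obtain ⟨R⟩ := h.nonempty_run hA.projection
    obtain ⟨S', s', ⟨R'⟩, hb⟩ := R.exists_coloured
    exact ⟨S', s', R'.accepts, hb⟩
  · rintro ⟨S', s', h, hb⟩
    obtain ⟨R⟩ := h.nonempty_run hA
    obtain ⟨R'⟩ := R.projection_of_bisimilar hF hb
    exact R'.accepts
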